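/- \textbf{Setting.} In RL with once-per-episode feedback, an agent interacts for $K$ episodes with a finite-horizon time-homogeneous MDP $(\mathcal S,\mathcal A,H,\mathbb P)$ with nonempty finite state and action spaces and a fixed initial state $s_1$. In episode $k$ it chooses a (randomised, history-dependent) policy $\pi_k$ on the basis of the trajectories and feedbacks of the earlier episodes and possibly of internal randomness, executes it, and observes the trajectory $\tau_k=(s_1,a_1,\dots,s_H,a_H)$ and a binary feedback $y_k\in\{0,1\}$ with $\Pr(y_k=1\mid\tau_k)=g^*(\tau_k)$, where $g^*:\mathrm{Traj}\to[0,1]$ is defined on the set $\mathrm{Traj}$ of $H$-step trajectories. With $V_1^\pi(s_1)=\mathbb E_{\tau\sim(\mathbb P,\pi)}[g^*(\tau)]$ and $V_1^*(s_1)=\sup_\pi V_1^\pi(s_1)$, the expected regret is $\mathbb E[\mathrm{Reg}(K)]=\mathbb E\sum_{k=1}^K\bigl(V_1^*(s_1)-V_1^{\pi_k}(s_1)\bigr)$. A $\tilde d_{\mathbb P}$-dimensional linear mixture MDP with parameter bound $B$ has $\mathbb P(s'\mid s,a)=\psi(s,a,s')^\top\theta$ with a known feature map $\psi:\mathcal S\times\mathcal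 A\times\mathcal S\to\mathbb R^{\tilde d_{\mathbb P}}$ such that $\|\sum_{s'}\psi(s,a,s')V(s')\|_2\le 1$ for all $s,a$ and all $V:\mathcal S\to[0,1]$, and an unknown $\theta$ with $\|\theta\|_2\le B$. A $\tilde d_{\mathbb G}$-dimensional linear feedback function with bounds $(L,M)$ has $g^*(\tau)=\phi(\tau)^\top w$ with a known feature map $\phi:\mathrm{Traj}\to\mathbb R^{\tilde d_{\mathbb G}}$, $\|\phi(\tau)\|_2\le L$, and an unknown $w$ with $\|w\|_2\le M$. \textbf{Theorem.} For all $B_0>1$ and $\rho>0$ there is a constant $c>0$ such that the following holds for all $B\ge B_0$, all $L,M>0$ with $LM\ge\rho$, all integers $\tilde d_{\mathbb P},\tilde d_{\mathbb G}\ge 1$ that are not both equal to $1$, and all $H\ge 2$. There are nonempty finite sets $\mathcal S,\mathcal A$, an initial state $s_1\in\mathcal S$ and feature maps $\psi,\phi$ as above such that for every $K\ge\max\{\tilde d_{\mathbb P},\tilde d_{\mathbb G}\}^2$ and every algorithm for RL with once-per-episode feedback (which may be randomised and may depend on $K$ and on all of these data) there are a $\tilde d_{\mathbb P}$-dimensional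 linear mixture MDP with features $\psi$ and parameter bound $B$ and a $\tilde d_{\mathbb G}$-dimensional linear feedback function with features $\phi$ and bounds $(L,M)$ on which the expected regret of the algorithm satisfies $$\mathbb E[\mathrm{Reg}(K)]\;\ge\; c\,\bigl(\tilde d_{\mathbb P}\sqrt K+\tilde d_{\mathbb G}\sqrt K\bigr).$$ -/

import Mathlib

open scoped NNReal ENNReal

namespace OnceRL

noncomputable section

/-- The law of a binary feedback that is `true` (that is, `1`) with probability `p`. -/
def feedbackLaw (p : unitInterval) : PMF Bool :=
  PMF.ofFintype (fun b =>
      cond b (unitInterval.toNNReal p : ℝ≥0∞) (1 - (unitInterval.toNNReal p : ℝ≥0∞))) (by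
    have h : (unitInterval.toNNReal p : ℝ≥0∞) ≤ 1 := by
      exact_mod_cast (show unitInterval.toNNReal p ≤ 1 from p.2.2)
    simp [h])

/-- A (randomised, history-dependent) policy: given the state-action pairs of the first `n` steps
of the current episode and the current state, a distribution over the next action. -/
abbrev Policy (S A : Type) : Type :=
  (n : ℕ) → (Fin n → S × A) → S → PMF A

/-- Trajectories `(s_1, a_1, …, s_H, a_H)`. -/
abbrev Traj (S A : Type) (H : ℕ) : Type := Fin H → S × A

/-- The law of the state that follows the first `n` state-action pairs of an episode: the fixed
initial state when `n = 0`, and a draw from the transition kernel otherwise. -/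
def nextState {S A : Type} (P : S → A → PMF S) (s₁ : S) : (n : ℕ) → (Fin n → S × A) → PMF S
  | 0, _ => PMF.pure s₁
  | n + 1, τ => P (τ (Fin.last n)).1 (τ (Fin.last n)).2

/-- The law of the first `n` state-action pairs of an episode in which `π` is executed in the MDP
with transition kernel `P` and initial state `s₁`. For `n = H` it is the law of `τ ∼ (P, π)`. -/
def trajLaw {S A : Type} (P : S → A → PMF S) (s₁ : S) (π : Policy S A) :
    (n : ℕ) → PMF (Traj S A n)
  | 0 => PMF.pure Fin.elim0
  | n + 1 =>
    (trajLaw P s₁ π n).bind fun τ =>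
      (nextState P s₁ n τ).bind fun s =>
        (π n τ s).bind fun a =>
          PMF.pure (Fin.snoc τ (s, a) : Fin (n + 1) → S × A)

/-- The value `V₁^π(s₁)` of a policy: the expectation of `g τ` for `τ ∼ (P, π)`. -/
def value {S A : Type} [Fintype S] [Fintype A] {H : ℕ} (P : S → A → PMF S) (s₁ : S)
    (g : Traj S A H → unitInterval) (π : Policy S A) : ℝ :=
  ∑ τ : Traj S A H, (trajLaw P s₁ π H τ).toReal * (g τ : ℝ)

/-- The optimal value `V₁^*(s₁)`, over all history-dependent policies. -/
def optValue {S A : Type} [Fintype S] [Fintype A] {H : ℕ} (P : S → A → PMF S) (s₁ : S)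
    (g : Traj S A H → unitInterval) : ℝ :=
  ⨆ π : Policy S A, value P s₁ g π

/-- What the agent has seen in the first `k` episodes: the trajectories and the feedbacks. -/
abbrev History (S A : Type) (H k : ℕ) : Type := Fin k → Traj S A H × Bool

/-- An algorithm for RL with once-per-episode feedback, possibly randomised through a random seed
in `Ω`: from the seed and the trajectories and feedbacks of the first `k` episodes it chooses the
policy that it executes in the next one, measurably in the seed. -/
structure Algorithm (S A : Type) (H : ℕ) (Ω : Type*) [MeasurableSpace Ω] where
  policy : Ω → (k : ℕ) → History S A H k → Policy S A
  measurable_policy : ∀ (k : ℕ) (hist : History S A H k) (n : ℕ) (τ : Fin n → S × A) (s : S)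
    (a : A), Measurable fun ω => policy ω k hist n τ s a

/-- The law of the history after `k` episodes when in episode `j + 1` the policy `alg j hist` is
executed, `hist` being the history of the first `j` episodes, and the feedback on the resulting
trajectory `τ` is Bernoulli with mean `g τ`. -/
def historyLaw {S A : Type} {H : ℕ} (P : S → A → PMF S) (s₁ : S) (g : Traj S A H → unitInterval)
    (alg : (k : ℕ) → History S A H k → Policy S A) : (k : ℕ) → PMF (History S A H k)
  | 0 => PMF.pure Fin.elim0
  | k + 1 =>
    (historyLaw P s₁ g alg k).bind fun hist =>
      (trajLaw P s₁ (alg k hist) H).bind fun τ =>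
        (feedbackLaw (g τ)).bind fun y =>
          PMF.pure (Fin.snoc hist (τ, y) : Fin (k + 1) → Traj S A H × Bool)

/-- The regret `∑_{k = 1}^K (V₁^*(s₁) - V₁^{π_k}(s₁))` along a given history of `K` episodes. -/
def regret {S A : Type} [Fintype S] [Fintype A] {H : ℕ} (P : S → A → PMF S) (s₁ : S)
    (g : Traj S A H → unitInterval) (alg : (k : ℕ) → History S A H k → Policy S A) (K : ℕ)
    (hist : History S A H K) : ℝ :=
  ∑ k : Fin K, (optValue P s₁ g -
    value P s₁ g (alg k fun j : Fin (k : ℕ) => hist (Fin.castLE k.isLt.le j)))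

/-- The expected regret of an algorithm over `K` episodes; the expectation is over the random seed,
the trajectories and the feedbacks. -/
def expectedRegret {S A : Type} [Fintype S] [Fintype A] {H : ℕ} (P : S → A → PMF S) (s₁ : S)
    (g : Traj S A H → unitInterval) {Ω : Type*} [MeasurableSpace Ω] (ν : MeasureTheory.Measure Ω)
    (alg : Algorithm S A H Ω) (K : ℕ) : ℝ :=
  ∫ ω, ∑ hist : History S A H K,
    (historyLaw P s₁ g (alg.policy ω) K hist).toReal * regret P s₁ g (alg.policy ω) K hist ∂ν

/-- Admissible feature maps for `d`-dimensional linear mixture MDPs: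
`‖∑_{s'} ψ(s, a, s') V(s')‖₂ ≤ 1` for all `s`, `a` and all `V : S → [0, 1]`. -/
def IsMixtureFeature {S A : Type} [Fintype S] {d : ℕ}
    (ψ : S → A → S → EuclideanSpace ℝ (Fin d)) : Prop :=
  ∀ (s : S) (a : A) (V : S → unitInterval), ‖∑ s', (V s' : ℝ) • ψ s a s'‖ ≤ 1

/-- `P` is the transition kernel `P(s' | s, a) = ⟨ψ(s, a, s'), θ⟩` with `‖θ‖₂ ≤ B`. -/
def IsLinearMixture {S A : Type} {d : ℕ} (ψ : S → A → S → EuclideanSpace ℝ (Fin d)) (B : ℝ)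
    (P : S → A → PMF S) : Prop :=
  ∃ θ : EuclideanSpace ℝ (Fin d), ‖θ‖ ≤ B ∧
    ∀ s a s', (P s a s').toReal = inner ℝ (ψ s a s') θ

/-- `g` is the linear feedback function `g(τ) = ⟨φ(τ), w⟩` with `‖w‖₂ ≤ M`. -/
def IsLinearFeedback {S A : Type} {H d : ℕ} (φ : Traj S A H → EuclideanSpace ℝ (Fin d)) (M : ℝ)
    (g : Traj S A H → unitInterval) : Prop :=
  ∃ w : EuclideanSpace ℝ (Fin d), ‖w‖ ≤ M ∧ ∀ τ, (g τ : ℝ) = inner ℝ (φ τ) w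

end

end OnceRL

/-! This is Assouad's method on a hypercube of instances. Actions and hidden parameters `θ` are sign
vectors of length `d`, one less than the larger dimension, since one feature coordinate carries a
constant. Only the first action `a` of an episode matters: it yields a success with probability `α +
ε⟨a, θ⟩`, where `ε` is of order `1/√K`, so each wrong sign costs a multiple of `ε` (`sum_mul_corr`).

Flipping one sign of `θ` lowers the Bhattacharyya coefficient of one episode to no less than `1 -
O(ε²)`, whatever the policy (`bhatt_biased_ge`). The coefficient multiplies along adaptively chosen
episodes (`bhatt_historyLaw_ge`), so after `K` episodes it is still at least `1/2`. The two
histories then overlap so much that the sign is wrong in a constant fraction of the episodes for one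
of the two parameters (`sum_missProb_add_flip_ge`). Averaging over coordinates and `θ` gives an
instance with regret of order `ε d K`, that is, `d√K` (`exists_expectedRegret_ge`).

The sum of the dimensions is at most twice the larger one, so only that one has to be made hard. If
it is the feedback dimension, there is a single state and the success is the feedback bit; otherwise
the success is a transition to a rewarding absorbing state, and the feedback function is the same
for all `θ`. The features do not involve `K`: the scale `ε` enters only through the unknown
parameters. -/

namespace OnceRL

noncomputable section

/-! ### Joint laws on finite products -/

section Laws

variable {X Y : Type}

/-- The law of a pair whose first component has law `p` and whose second component has
conditional law `q`. -/
def pairLaw (p : PMF X) (q : X → PMF Y) : PMF (X × Y) :=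
  p.bind fun x => (q x).bind fun y => PMF.pure (x, y)

/-- The law of a sequence with law `p` that is extended by an entry with conditional law `q`. -/
def snocLaw {n : ℕ} (p : PMF (Fin n → X)) (q : (Fin n → X) → PMF X) : PMF (Fin (n + 1) → X) :=
  p.bind fun t => (q t).bind fun x => PMF.pure (Fin.snoc t x : Fin (n + 1) → X)

theorem pairLaw_apply (p : PMF X) (q : X → PMF Y) (x : X) (y : Y) :
    pairLaw p q (x, y) = p x * q x y := by
  rw [pairLaw, PMF.bind_apply, tsum_eq_single x]
  · rw [PMF.bind_apply, tsum_eq_single y]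
    · simp
    · intro y' hy
      simp [PMF.pure_apply, hy.symm]
  · intro x' hx
    simp [PMF.bind_apply, PMF.pure_apply, hx.symm]

theorem snocLaw_snoc {n : ℕ} (p : PMF (Fin n → X)) (q : (Fin n → X) → PMF X)
    (t : Fin n → X) (x : X) :
    snocLaw p q (Fin.snoc t x : Fin (n + 1) → X) = p t * q t x := by
  have h : ∀ (t' : Fin n → X) (x' : X),
      ((Fin.snoc t x : Fin (n + 1) → X) = Fin.snoc t' x') ↔ t = t' ∧ x = x' := by
    intro t' x'
    exact Fin.snoc_inj (α := fun _ => X)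
  rw [snocLaw, PMF.bind_apply, tsum_eq_single t]
  · rw [PMF.bind_apply, tsum_eq_single x]
    · simp
    · intro y' hy
      simp [PMF.pure_apply, h, hy.symm]
  · intro x' hx
    simp [PMF.bind_apply, PMF.pure_apply, h, hx.symm]

theorem sum_snoc {n : ℕ} [Fintype X] (F : (Fin (n + 1) → X) → ℝ) :
    ∑ t, F t = ∑ t : Fin n → X, ∑ x, F (Fin.snoc t x : Fin (n + 1) → X) := by
  rw [← (Fin.snocEquiv (fun _ : Fin (n + 1) => X)).sum_comp, Fintype.sum_prod_type_right]
  rfl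

theorem sum_toReal [Fintype X] (p : PMF X) : ∑ x, (p x).toReal = 1 := by
  rw [← ENNReal.toReal_sum (fun x _ => p.apply_ne_top x)]
  have h := p.tsum_coe
  rw [tsum_fintype] at h
  simp [h]

end Laws

/-! ### Bhattacharyya coefficients -/

section Bhattacharyya

variable {X Y : Type} [Fintype X] [Fintype Y]

/-- The Bhattacharyya coefficient of two laws on a finite type. -/
def bhatt (p q : PMF X) : ℝ := ∑ x, √((p x).toReal * (q x).toReal)

theorem bhatt_self (p : PMF X) : bhatt p p = 1 := by
  simp [bhatt, sum_toReal]

theorem bhatt_pairLaw (p p' : PMF X) (q q' : X → PMF Y) :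
    bhatt (pairLaw p q) (pairLaw p' q') =
      ∑ x, √((p x).toReal * (p' x).toReal) * bhatt (q x) (q' x) := by
  simp only [bhatt, Fintype.sum_prod_type, Finset.mul_sum, pairLaw_apply, ENNReal.toReal_mul]
  refine Finset.sum_congr rfl fun x _ => Finset.sum_congr rfl fun y _ => ?_
  rw [← Real.sqrt_mul (by positivity)]
  ring_nf

theorem bhatt_snocLaw {n : ℕ} (p p' : PMF (Fin n → X)) (q q' : (Fin n → X) → PMF X) :
    bhatt (snocLaw p q) (snocLaw p' q') =
      ∑ t, √((p t).toReal * (p' t).toReal) * bhatt (q t) (q' t) := by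
  simp only [bhatt, sum_snoc, Finset.mul_sum, snocLaw_snoc, ENNReal.toReal_mul]
  refine Finset.sum_congr rfl fun x _ => Finset.sum_congr rfl fun y _ => ?_
  rw [← Real.sqrt_mul (by positivity)]
  ring_nf

theorem mul_bhatt_le {p p' : PMF X} {f : X → ℝ} {c : ℝ} (h : ∀ x, c ≤ f x) :
    bhatt p p' * c ≤ ∑ x, √((p x).toReal * (p' x).toReal) * f x := by
  rw [bhatt, Finset.sum_mul]
  gcongr with x
  exact h x

/-- Cauchy–Schwarz applied to `p q = min p q * max p q`; the maxima have total mass at most 2. -/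
theorem bhatt_sq_le (p q : PMF X) :
    bhatt p q ^ 2 ≤ 2 * ∑ x, min (p x).toReal (q x).toReal := by
  have h1 : bhatt p q =
      ∑ x, √(min (p x).toReal (q x).toReal) * √(max (p x).toReal (q x).toReal) := by
    refine Finset.sum_congr rfl fun x _ => ?_
    rw [← Real.sqrt_mul (by positivity), min_mul_max]
  have h2 := Finset.sum_mul_sq_le_sq_mul_sq Finset.univ
    (fun x => √(min (p x).toReal (q x).toReal)) (fun x => √(max (p x).toReal (q x).toReal))
  have h3 : ∀ x, √(min (p x).toReal (q x).toReal) ^ 2 = min (p x).toReal (q x).toReal :=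
    fun x => Real.sq_sqrt (by positivity)
  have h4 : ∀ x, √(max (p x).toReal (q x).toReal) ^ 2 = max (p x).toReal (q x).toReal :=
    fun x => Real.sq_sqrt (by positivity)
  have h5 : ∑ x, max (p x).toReal (q x).toReal ≤ 2 := by
    calc ∑ x, max (p x).toReal (q x).toReal ≤ ∑ x, ((p x).toReal + (q x).toReal) := by
          gcongr with x
          exact max_le_add_of_nonneg ENNReal.toReal_nonneg ENNReal.toReal_nonneg
      _ = 2 := by rw [Finset.sum_add_distrib, sum_toReal, sum_toReal]; norm_num
  have h6 : 0 ≤ ∑ x, min (p x).toReal (q x).toReal :=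
    Finset.sum_nonneg fun x _ => by positivity
  rw [← h1] at h2
  simp only [h3, h4] at h2
  nlinarith

theorem feedbackLaw_true (p : unitInterval) : (feedbackLaw p true).toReal = p := by
  simp [feedbackLaw]

theorem feedbackLaw_false (p : unitInterval) : (feedbackLaw p false).toReal = 1 - p := by
  have h := sum_toReal (feedbackLaw p)
  rw [Fintype.sum_bool, feedbackLaw_true] at h
  linarith

/-- The difference of the arithmetic and geometric means, multiplied by their sum, is `(p - q)² /
4`, and the sum is at least `2 * m`. -/
theorem sqrt_mul_ge {m p q : ℝ} (hm : 0 < m) (hp : m ≤ p) (hq : m ≤ q) :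
    (p + q) / 2 - (p - q) ^ 2 / (4 * m) ≤ √(p * q) := by
  have h0 : 0 ≤ p * q := mul_nonneg (by linarith) (by linarith)
  have hs := Real.sq_sqrt h0
  have hmn : m ≤ √(p * q) := Real.le_sqrt_of_sq_le (by nlinarith)
  have h1 : ((p + q) / 2 - √(p * q)) * ((p + q) / 2 + √(p * q)) = (p - q) ^ 2 / 4 := by
    nlinarith
  have h2 : 0 ≤ (p + q) / 2 - √(p * q) := by
    by_contra hneg
    push Not at hneg
    nlinarith [sq_nonneg (p - q)]
  rw [sub_le_iff_le_add, ← sub_le_iff_le_add', le_div_iff₀ (by positivity)]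
  nlinarith

theorem bhatt_feedbackLaw_ge {m : ℝ} (hm : 0 < m) {p q : unitInterval} (hp : m ≤ p)
    (hp' : p ≤ 1 - m) (hq : m ≤ q) (hq' : q ≤ 1 - m) :
    1 - ((p : ℝ) - q) ^ 2 / (2 * m) ≤ bhatt (feedbackLaw p) (feedbackLaw q) := by
  rw [bhatt, Fintype.sum_bool]
  simp only [feedbackLaw_true, feedbackLaw_false]
  have h1 := sqrt_mul_ge hm hp hq
  have h2 := sqrt_mul_ge hm (show m ≤ 1 - (p : ℝ) by linarith) (show m ≤ 1 - (q : ℝ) by linarith)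
  have h3 : ((p : ℝ) - q) ^ 2 / (2 * m) =
      ((p : ℝ) - q) ^ 2 / (4 * m) + (1 - (p : ℝ) - (1 - q)) ^ 2 / (4 * m) := by
    field_simp
    ring
  linarith

end Bhattacharyya

/-! ### Laws of episodes and histories -/

section Episodes

variable {S A : Type}

/-- The law of the trajectory and the feedback of an episode in which `π` is executed. -/
def episodeLaw {H : ℕ} (P : S → A → PMF S) (s₁ : S) (g : Traj S A H → unitInterval)
    (π : Policy S A) : PMF (Traj S A H × Bool) :=
  pairLaw (trajLaw P s₁ π H) fun τ => feedbackLaw (g τ)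

theorem trajLaw_succ (P : S → A → PMF S) (s₁ : S) (π : Policy S A) (n : ℕ) :
    trajLaw P s₁ π (n + 1) =
      snocLaw (trajLaw P s₁ π n) fun τ => pairLaw (nextState P s₁ n τ) (π n τ) := by
  simp [trajLaw, snocLaw, pairLaw, PMF.bind_bind, PMF.pure_bind]

theorem trajLaw_snoc (P : S → A → PMF S) (s₁ : S) (π : Policy S A) (n : ℕ)
    (τ : Traj S A n) (s : S) (a : A) :
    trajLaw P s₁ π (n + 1) (Fin.snoc τ (s, a) : Fin (n + 1) → S × A) =
      trajLaw P s₁ π n τ * (nextState P s₁ n τ s * π n τ s a) := by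
  rw [trajLaw_succ, snocLaw_snoc, pairLaw_apply]

theorem historyLaw_succ {H : ℕ} (P : S → A → PMF S) (s₁ : S) (g : Traj S A H → unitInterval)
    (alg : (k : ℕ) → History S A H k → Policy S A) (k : ℕ) :
    historyLaw P s₁ g alg (k + 1) =
      snocLaw (historyLaw P s₁ g alg k) fun hist => episodeLaw P s₁ g (alg k hist) := by
  simp [historyLaw, snocLaw, pairLaw, episodeLaw, PMF.bind_bind, PMF.pure_bind]

variable [Fintype S] [Fintype A]

/-- The action is drawn from the same law on both sides, so only the transition contributes a
factor. -/
theorem bhatt_trajLaw_succ (P P' : S → A → PMF S) (s₁ : S) (π : Policy S A) (n : ℕ) :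
    bhatt (trajLaw P s₁ π (n + 1)) (trajLaw P' s₁ π (n + 1)) =
      ∑ τ, √((trajLaw P s₁ π n τ).toReal * (trajLaw P' s₁ π n τ).toReal) *
        bhatt (nextState P s₁ n τ) (nextState P' s₁ n τ) := by
  simp only [trajLaw_succ, bhatt_snocLaw, bhatt_pairLaw, bhatt_self, mul_one]
  rfl

/-- Adaptivity does no harm: the one-episode bound is uniform in the policy, hence holds
conditionally on every history. -/
theorem bhatt_historyLaw_ge {H : ℕ} {P P' : S → A → PMF S} {s₁ : S}
    {g g' : Traj S A H → unitInterval} {c : ℝ} (hc : 0 ≤ c)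
    (h : ∀ π, c ≤ bhatt (episodeLaw P s₁ g π) (episodeLaw P' s₁ g' π))
    (alg : (k : ℕ) → History S A H k → Policy S A) (k : ℕ) :
    c ^ k ≤ bhatt (historyLaw P s₁ g alg k) (historyLaw P' s₁ g' alg k) := by
  induction k with
  | zero => simp [historyLaw, bhatt_self]
  | succ k ih =>
    rw [historyLaw_succ, historyLaw_succ, bhatt_snocLaw, pow_succ]
    exact (mul_le_mul_of_nonneg_right ih hc).trans (mul_bhatt_le fun hist => h _)

/-- The expectation of a function of the first two states and the first action. -/
theorem sum_trajLaw_mul (P : S → A → PMF S) (s₁ : S) (π : Policy S A) (f : A → S → ℝ) (n : ℕ) :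
    ∑ τ : Traj S A (n + 2), (trajLaw P s₁ π (n + 2) τ).toReal * f (τ 0).2 (τ 1).1 =
      ∑ a, (π 0 Fin.elim0 s₁ a).toReal * ∑ s, (P s₁ a s).toReal * f a s := by
  classical
  induction n with
  | zero =>
    have h0 : ∀ (t : Fin 0 → S × A) x y,
        (Fin.snoc (Fin.snoc t x : Fin 1 → S × A) y : Fin 2 → S × A) 0 = x := fun _ _ _ => rfl
    have h1 : ∀ (t : Fin 0 → S × A) x y,
        (Fin.snoc (Fin.snoc t x : Fin 1 → S × A) y : Fin 2 → S × A) 1 = y := fun _ _ _ => rfl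
    rw [sum_snoc, sum_snoc]
    have h2 : ∀ (t : Fin 0 → S × A) x s, nextState P s₁ 1 (Fin.snoc t x : Fin 1 → S × A) s =
        P x.1 x.2 s := fun _ _ _ => rfl
    have h3 : ∀ (t : Fin 1 → S × A) s' a s, ∑ a', (trajLaw P s₁ π 1 t).toReal *
        ((P s a s').toReal * (π 1 t s' a').toReal) * f a s' =
          (trajLaw P s₁ π 1 t).toReal * ((P s a s').toReal * f a s') := by
      intro t s' a s
      rw [← Finset.sum_mul, ← Finset.mul_sum, ← Finset.mul_sum, sum_toReal]
      ring
    have h4 : ∀ t : Fin 0 → S × A, t = Fin.elim0 := fun t => Subsingleton.elim _ _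
    simp only [Nat.reduceAdd, h0, h1, Fintype.sum_prod_type, trajLaw_snoc _ _ _ 1,
      ENNReal.toReal_mul, h2, h3]
    simp only [← Finset.mul_sum, Finset.univ_unique, Finset.sum_singleton, h4 default, trajLaw,
      nextState]
    rw [Finset.sum_eq_single s₁]
    · simp
    · intro s _ hs
      simp [hs]
    · simp
  | succ n ih =>
    rw [← ih, sum_snoc]
    refine Finset.sum_congr rfl fun τ _ => ?_
    have h0 : ∀ x, (Fin.snoc τ x : Fin (n + 3) → S × A) 0 = τ 0 :=
      fun x => Fin.snoc_castSucc (α := fun _ => S × A) x τ 0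
    have h1 : ∀ x, (Fin.snoc τ x : Fin (n + 3) → S × A) 1 = τ 1 :=
      fun x => Fin.snoc_castSucc (α := fun _ => S × A) x τ 1
    simp only [h0, h1]
    rw [← Finset.sum_mul, trajLaw_succ]
    simp only [snocLaw_snoc, ENNReal.toReal_mul]
    rw [← Finset.mul_sum, sum_toReal, mul_one]

theorem value_le_one {H : ℕ} (P : S → A → PMF S) (s₁ : S) (g : Traj S A H → unitInterval)
    (π : Policy S A) : value P s₁ g π ≤ 1 := by
  rw [value, ← sum_toReal (trajLaw P s₁ π H)]
  gcongr with τ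
  exact mul_le_of_le_one_right ENNReal.toReal_nonneg (g τ).2.2

theorem value_nonneg {H : ℕ} (P : S → A → PMF S) (s₁ : S) (g : Traj S A H → unitInterval)
    (π : Policy S A) : 0 ≤ value P s₁ g π :=
  Finset.sum_nonneg fun τ _ => mul_nonneg ENNReal.toReal_nonneg (g τ).2.1

theorem value_le_optValue {H : ℕ} (P : S → A → PMF S) (s₁ : S) (g : Traj S A H → unitInterval)
    (π : Policy S A) : value P s₁ g π ≤ optValue P s₁ g :=
  le_ciSup (f := value P s₁ g) ⟨1, by rintro _ ⟨π, rfl⟩; exact value_le_one P s₁ g π⟩ π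

end Episodes

/-! ### Measurability and integrability in the random seed -/

section Measurability

variable {S A : Type} {H : ℕ} {Ω : Type*} [MeasurableSpace Ω]

theorem measurable_trajLaw (P : S → A → PMF S) (s₁ : S) {π : Ω → Policy S A}
    (hπ : ∀ n τ s a, Measurable fun ω => π ω n τ s a) (n : ℕ) (τ : Traj S A n) :
    Measurable fun ω => trajLaw P s₁ (π ω) n τ := by
  induction n with
  | zero => exact measurable_const
  | succ n ih =>
    rw [← Fin.snoc_init_self τ]
    obtain ⟨s, a⟩ := τ (Fin.last n)
    simp only [trajLaw_snoc]
    exact (ih _).mul (measurable_const.mul (hπ _ _ _ _))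

theorem measurable_historyLaw (P : S → A → PMF S) (s₁ : S) (g : Traj S A H → unitInterval)
    (alg : Algorithm S A H Ω) (k : ℕ) (hist : History S A H k) :
    Measurable fun ω => historyLaw P s₁ g (alg.policy ω) k hist := by
  induction k with
  | zero => exact measurable_const
  | succ k ih =>
    rw [← Fin.snoc_init_self hist]
    obtain ⟨τ, y⟩ := hist (Fin.last k)
    simp only [historyLaw_succ, snocLaw_snoc, episodeLaw, pairLaw_apply]
    exact (ih _).mul ((measurable_trajLaw P s₁ (alg.measurable_policy k _) H τ).mul
      measurable_const)

variable [Fintype S] [Fintype A]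

theorem measurable_regret (P : S → A → PMF S) (s₁ : S) (g : Traj S A H → unitInterval)
    (alg : Algorithm S A H Ω) (K : ℕ) (hist : History S A H K) :
    Measurable fun ω => regret P s₁ g (alg.policy ω) K hist := by
  unfold regret value
  refine Finset.measurable_sum _ fun k _ => measurable_const.sub ?_
  exact Finset.measurable_sum _ fun τ _ => Measurable.mul_const
    (measurable_trajLaw P s₁ (alg.measurable_policy k _) H τ).ennreal_toReal _

theorem abs_regret_le (P : S → A → PMF S) (s₁ : S) (g : Traj S A H → unitInterval)
    (alg : (k : ℕ) → History S A H k → Policy S A) (K : ℕ) (hist : History S A H K) :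
    |regret P s₁ g alg K hist| ≤ K * (|optValue P s₁ g| + 1) := by
  refine (Finset.abs_sum_le_sum_abs _ _).trans ?_
  refine (Finset.sum_le_card_nsmul _ _ (|optValue P s₁ g| + 1) fun k _ => ?_).trans
    (by simp [mul_add])
  refine (abs_sub _ _).trans ?_
  rw [abs_of_nonneg (value_nonneg P s₁ g _)]
  gcongr
  exact value_le_one P s₁ g _

theorem integrable_regret (P : S → A → PMF S) (s₁ : S) (g : Traj S A H → unitInterval)
    (ν : MeasureTheory.Measure Ω) [MeasureTheory.IsProbabilityMeasure ν]
    (alg : Algorithm S A H Ω) (K : ℕ) :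
    MeasureTheory.Integrable (fun ω => ∑ hist : History S A H K,
      (historyLaw P s₁ g (alg.policy ω) K hist).toReal *
        regret P s₁ g (alg.policy ω) K hist) ν := by
  refine MeasureTheory.Integrable.of_bound (C := K * (|optValue P s₁ g| + 1)) ?_ ?_
  · refine (Finset.measurable_sum _ fun hist _ => ?_).aestronglyMeasurable
    exact (measurable_historyLaw P s₁ g alg K hist).ennreal_toReal.mul
      (measurable_regret P s₁ g alg K hist)
  · refine MeasureTheory.ae_of_all _ fun ω => ?_
    refine (Finset.abs_sum_le_sum_abs _ _).trans ?_
    rw [← one_mul (K * (|optValue P s₁ g| + 1) : ℝ),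
      ← congrArg (· * (K * (|optValue P s₁ g| + 1) : ℝ))
        (sum_toReal (historyLaw P s₁ g (alg.policy ω) K)), Finset.sum_mul]
    gcongr with hist
    rw [abs_mul, abs_of_nonneg ENNReal.toReal_nonneg]
    gcongr
    exact abs_regret_le P s₁ g _ K hist

end Measurability

/-! ### Assouad's argument -/

section Hypercube

variable {S : Type} {H d : ℕ}

/-- The probability that the first action of `π` differs from `b` in coordinate `i`. -/
def missProb (π : Policy S (Fin d → Bool)) (s₁ : S) (i : Fin d) (b : Bool) : ℝ :=
  ∑ a, (π 0 Fin.elim0 s₁ a).toReal * if a i = b then 0 else 1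

theorem missProb_nonneg (π : Policy S (Fin d → Bool)) (s₁ : S) (i : Fin d) (b : Bool) :
    0 ≤ missProb π s₁ i b :=
  Finset.sum_nonneg fun a _ => by positivity

theorem missProb_add_not (π : Policy S (Fin d → Bool)) (s₁ : S) (i : Fin d) (b : Bool) :
    missProb π s₁ i b + missProb π s₁ i (!b) = 1 := by
  rw [missProb, missProb, ← Finset.sum_add_distrib]
  refine Eq.trans ?_ (sum_toReal (π 0 Fin.elim0 s₁))
  refine Finset.sum_congr rfl fun a _ => ?_
  cases a i <;> cases b <;> norm_num

/-- The vertex of the hypercube that differs from `θ` in coordinate `i` only. -/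
def flip (i : Fin d) (θ : Fin d → Bool) : Fin d → Bool := Function.update θ i (!θ i)

theorem flip_involutive (i : Fin d) : Function.Involutive (flip i) := by
  intro θ
  simp [flip]

theorem half_le_sum_of_flip {F : (Fin d → Bool) → ℝ} {c : ℝ} (i : Fin d)
    (h : ∀ θ, c ≤ F θ + F (flip i θ)) : 2 ^ d * (c / 2) ≤ ∑ θ, F θ := by
  have h1 : ∑ θ, F (flip i θ) = ∑ θ, F θ := 
    Equiv.sum_comp (flip_involutive i).toPerm F
  have h2 : ∑ _θ : Fin d → Bool, c ≤ ∑ θ, (F θ + F (flip i θ)) := Finset.sum_le_sum fun θ _ => h θ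
  rw [Finset.sum_add_distrib, h1] at h2
  simp at h2
  linarith

variable [Fintype S] (P : (Fin d → Bool) → S → (Fin d → Bool) → PMF S) (s₁ : S)
  (g : (Fin d → Bool) → Traj S (Fin d → Bool) H → unitInterval)

/-- Along any history the misses against `θ i` and against `!θ i` add up to `K`. Weighting both by
the common mass `min p q` of the two history laws leaves at least `K / 8`. -/
theorem sum_missProb_add_flip_ge {δ : ℝ} (hδ : δ ≤ 1) {K : ℕ} (hK : K * δ ≤ 1 / 2)
    (hb : ∀ θ i π, 1 - δ ≤
      bhatt (episodeLaw (P θ) s₁ (g θ) π) (episodeLaw (P (flip i θ)) s₁ (g (flip i θ)) π))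
    (alg : (k : ℕ) → History S (Fin d → Bool) H k → Policy S (Fin d → Bool))
    (θ : Fin d → Bool) (i : Fin d) :
    (K : ℝ) / 8 ≤
      ∑ hist : History S (Fin d → Bool) H K, (historyLaw (P θ) s₁ (g θ) alg K hist).toReal *
        ∑ k : Fin K, missProb (alg k fun j : Fin (k : ℕ) => hist (Fin.castLE k.isLt.le j))
          s₁ i (θ i) +
      ∑ hist : History S (Fin d → Bool) H K,
        (historyLaw (P (flip i θ)) s₁ (g (flip i θ)) alg K hist).toReal *
        ∑ k : Fin K, missProb (alg k fun j : Fin (k : ℕ) => hist (Fin.castLE k.isLt.le j))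
          s₁ i (flip i θ i) := by
  set p := historyLaw (P θ) s₁ (g θ) alg K
  set q := historyLaw (P (flip i θ)) s₁ (g (flip i θ)) alg K
  have h1 : 1 / 2 ≤ bhatt p q := by
    -- Bernoulli's inequality: `(1 - δ) ^ K ≥ 1 - K * δ ≥ 1 / 2`.
    have h2 := one_add_mul_le_pow (show -2 ≤ -δ by linarith) K
    have h3 := bhatt_historyLaw_ge (by linarith) (hb θ i) alg K
    rw [← sub_eq_add_neg] at h2
    linarith
  have h2 := bhatt_sq_le p q
  have h3 : 1 / 8 ≤ ∑ hist, min (p hist).toReal (q hist).toReal := by nlinarith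
  have hflip : flip i θ i = !θ i := by simp [flip]
  rw [← Finset.sum_add_distrib, hflip]
  calc (K : ℝ) / 8 ≤ ∑ hist, min (p hist).toReal (q hist).toReal * K := by
        rw [← Finset.sum_mul]
        nlinarith [(Nat.cast_nonneg K : (0 : ℝ) ≤ K)]
    _ ≤ _ := by
        gcongr with hist
        set π := fun k : Fin K => alg k fun j : Fin (k : ℕ) => hist (Fin.castLE k.isLt.le j)
        have h4 : (K : ℝ) = ∑ k, missProb (π k) s₁ i (θ i) + ∑ k, missProb (π k) s₁ i (!θ i) := by
          rw [← Finset.sum_add_distrib]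
          simp [missProb_add_not]
        have h5 : ∀ b, 0 ≤ ∑ k, missProb (π k) s₁ i b :=
          fun b => Finset.sum_nonneg fun k _ => missProb_nonneg _ _ _ _
        rw [h4, mul_add]
        gcongr
        · exact h5 _
        · exact min_le_left _ _
        · exact h5 _
        · exact min_le_right _ _

theorem gap_mul_sum_missProb_le {v gap : ℝ}
    (hval : ∀ θ π, value (P θ) s₁ (g θ) π = v - gap * ∑ i, missProb π s₁ i (θ i))
    (θ : Fin d → Bool) (π : Policy S (Fin d → Bool)) :
    gap * ∑ i, missProb π s₁ i (θ i) ≤ optValue (P θ) s₁ (g θ) - value (P θ) s₁ (g θ) π := by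
  -- The policy that always plays `θ` never misses, so the optimal value is at least `v`.
  have h := value_le_optValue (P θ) s₁ (g θ) fun _ _ _ => PMF.pure θ
  have h1 : ∀ i, missProb (fun _ _ _ => PMF.pure θ) s₁ i (θ i) = 0 := by
    intro i
    refine Finset.sum_eq_zero fun a _ => ?_
    by_cases ha : a = θ <;> simp [PMF.pure_apply, ha]
  rw [hval] at h
  simp only [h1, Finset.sum_const_zero] at h
  rw [hval]
  linarith

theorem sum_regret_ge {v gap δ : ℝ} (hgap : 0 ≤ gap)
    (hval : ∀ θ π, value (P θ) s₁ (g θ) π = v - gap * ∑ i, missProb π s₁ i (θ i))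
    (hδ : δ ≤ 1) {K : ℕ} (hK : K * δ ≤ 1 / 2)
    (hb : ∀ θ i π, 1 - δ ≤
      bhatt (episodeLaw (P θ) s₁ (g θ) π) (episodeLaw (P (flip i θ)) s₁ (g (flip i θ)) π))
    (alg : (k : ℕ) → History S (Fin d → Bool) H k → Policy S (Fin d → Bool)) :
    2 ^ d * (gap * d * K / 16) ≤ ∑ θ, ∑ hist : History S (Fin d → Bool) H K,
      (historyLaw (P θ) s₁ (g θ) alg K hist).toReal * regret (P θ) s₁ (g θ) alg K hist := by
  set F : Fin d → (Fin d → Bool) → ℝ := fun i θ =>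
    ∑ hist : History S (Fin d → Bool) H K, (historyLaw (P θ) s₁ (g θ) alg K hist).toReal *
      ∑ k : Fin K, missProb (alg k fun j : Fin (k : ℕ) => hist (Fin.castLE k.isLt.le j))
        s₁ i (θ i) with hF
  have h1 : ∀ i, 2 ^ d * ((K : ℝ) / 8 / 2) ≤ ∑ θ, F i θ := fun i =>
    half_le_sum_of_flip i fun θ => sum_missProb_add_flip_ge P s₁ g hδ hK hb alg θ i
  have h2 : (d : ℝ) * (2 ^ d * ((K : ℝ) / 8 / 2)) ≤ ∑ i, ∑ θ, F i θ := by
    simpa using Finset.card_nsmul_le_sum Finset.univ (fun i => ∑ θ, F i θ) _ fun i _ => h1 i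
  calc 2 ^ d * (gap * d * K / 16) = gap * ((d : ℝ) * (2 ^ d * ((K : ℝ) / 8 / 2))) := by ring
    _ ≤ gap * ∑ i, ∑ θ, F i θ := by gcongr
    _ = ∑ θ, gap * ∑ i, F i θ := by rw [Finset.sum_comm, Finset.mul_sum]
    _ ≤ _ := by
      gcongr with θ
      rw [hF, Finset.sum_comm, Finset.mul_sum]
      refine Finset.sum_le_sum fun hist _ => ?_
      rw [← Finset.mul_sum, mul_left_comm]
      refine mul_le_mul_of_nonneg_left ?_ ENNReal.toReal_nonneg
      rw [Finset.sum_comm, Finset.mul_sum]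
      exact Finset.sum_le_sum fun k _ => gap_mul_sum_missProb_le P s₁ g hval θ _

/-- A hypercube of instances in which each coordinate of the first action that differs from the
parameter costs `gap`, while an episode hardly distinguishes neighbouring parameters, contains an
instance of large regret. -/
theorem exists_expectedRegret_ge {v gap δ : ℝ} (hgap : 0 ≤ gap)
    (hval : ∀ θ π, value (P θ) s₁ (g θ) π = v - gap * ∑ i, missProb π s₁ i (θ i))
    (hδ : δ ≤ 1) {K : ℕ} (hK : K * δ ≤ 1 / 2)
    (hb : ∀ θ i π, 1 - δ ≤
      bhatt (episodeLaw (P θ) s₁ (g θ) π) (episodeLaw (P (flip i θ)) s₁ (g (flip i θ)) π))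
    {Ω : Type*} [MeasurableSpace Ω] (ν : MeasureTheory.Measure Ω)
    [MeasureTheory.IsProbabilityMeasure ν] (alg : Algorithm S (Fin d → Bool) H Ω) :
    ∃ θ, gap * d * K / 16 ≤ expectedRegret (P θ) s₁ (g θ) ν alg K := by
  have h1 : 2 ^ d * (gap * d * K / 16) ≤ ∑ θ, expectedRegret (P θ) s₁ (g θ) ν alg K := by
    unfold expectedRegret
    -- The sum over `θ` goes inside the integral, where the bound holds for each fixed seed;
    -- choosing `θ` only afterwards makes it independent of the seed.
    rw [← MeasureTheory.integral_finsetSum _ fun θ _ => integrable_regret _ s₁ _ ν alg K]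
    calc 2 ^ d * (gap * d * K / 16) = ∫ _, 2 ^ d * (gap * d * K / 16) ∂ν := by simp
      _ ≤ _ := MeasureTheory.integral_mono (MeasureTheory.integrable_const _)
        (MeasureTheory.integrable_finsetSum _ fun θ _ => integrable_regret _ s₁ _ ν alg K)
        fun ω => sum_regret_ge P s₁ g hgap hval hδ hK hb (alg.policy ω)
  have h2 : ∑ _θ : Fin d → Bool, gap * d * K / 16 ≤
      ∑ θ, expectedRegret (P θ) s₁ (g θ) ν alg K := by simpa using h1
  obtain ⟨θ, -, hθ⟩ := Finset.exists_le_of_sum_le Finset.univ_nonempty h2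
  exact ⟨θ, hθ⟩

end Hypercube

/-! ### Sign vectors and biased coins -/

section Signs

variable {d : ℕ}

/-- The sign encoded by a Boolean. -/
def sgn (b : Bool) : ℝ := cond b 1 (-1)

theorem sgn_sq (b : Bool) : sgn b ^ 2 = 1 := by cases b <;> simp [sgn]

/-- The inner product of two sign vectors. -/
def corr (a θ : Fin d → Bool) : ℝ := ∑ i, sgn (a i) * sgn (θ i)

theorem corr_eq (a θ : Fin d → Bool) :
    corr a θ = d - 2 * ∑ i, if a i = θ i then (0 : ℝ) else 1 := by
  have h : ∀ i, sgn (a i) * sgn (θ i) = 1 - 2 * if a i = θ i then (0 : ℝ) else 1 := by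
    intro i
    cases a i <;> cases θ i <;> norm_num [sgn]
  simp only [corr, h, Finset.sum_sub_distrib, ← Finset.mul_sum]
  simp

theorem abs_corr_le (a θ : Fin d → Bool) : |corr a θ| ≤ d := by
  refine (Finset.abs_sum_le_sum_abs _ _).trans ?_
  have h : ∀ i, |sgn (a i) * sgn (θ i)| = 1 := by
    intro i
    cases a i <;> cases θ i <;> simp [sgn]
  simp [h]

theorem corr_sub_flip_sq (a θ : Fin d → Bool) (i : Fin d) :
    (corr a θ - corr a (flip i θ)) ^ 2 = 4 := by
  have h : corr a θ - corr a (flip i θ) = 2 * sgn (a i) * sgn (θ i) := by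
    rw [corr, corr, ← Finset.sum_sub_distrib, Finset.sum_eq_single i]
    · cases h : θ i <;> simp [flip, sgn, h] <;> ring
    · intro j _ hj
      simp [flip, hj]
    · simp
  rw [h, mul_pow, mul_pow, sgn_sq, sgn_sq]
  norm_num

theorem sum_mul_corr {S : Type} (π : Policy S (Fin d → Bool)) (s₁ : S) (θ : Fin d → Bool)
    (α ε : ℝ) :
    ∑ a, (π 0 Fin.elim0 s₁ a).toReal * (α + ε * corr a θ) =
      α + ε * d - 2 * ε * ∑ i, missProb π s₁ i (θ i) := by
  have h : ∀ a : Fin d → Bool, (π 0 Fin.elim0 s₁ a).toReal * (α + ε * corr a θ) =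
      (α + ε * d) * (π 0 Fin.elim0 s₁ a).toReal -
        2 * ε * ∑ i, (π 0 Fin.elim0 s₁ a).toReal * if a i = θ i then 0 else 1 := by
    intro a
    rw [corr_eq, ← Finset.mul_sum]
    ring
  simp only [h, Finset.sum_sub_distrib]
  rw [← Finset.mul_sum, sum_toReal, mul_one, ← Finset.mul_sum, Finset.sum_comm]
  rfl

/-- The probability `α + ε ⟨a, θ⟩`. -/
def biased (α ε : ℝ) (a θ : Fin d → Bool) : unitInterval :=
  Set.projIcc 0 1 zero_le_one (α + ε * corr a θ)

theorem abs_mul_corr_le {ε : ℝ} (hε : 0 ≤ ε) (a θ : Fin d → Bool) :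
    |ε * corr a θ| ≤ ε * d := by
  rw [abs_mul, abs_of_nonneg hε]
  exact mul_le_mul_of_nonneg_left (abs_corr_le a θ) hε

/-- The projection to the unit interval is inactive in the range of parameters used. -/
theorem coe_biased {α ε m : ℝ} (hm : 0 < m) (hε : 0 ≤ ε) (h1 : m ≤ α - ε * d)
    (h2 : α + ε * d ≤ 1 - m) (a θ : Fin d → Bool) :
    (biased α ε a θ : ℝ) = α + ε * corr a θ := by
  have h := abs_le.mp (abs_mul_corr_le hε a θ)
  rw [biased, Set.projIcc_of_mem zero_le_one ⟨by linarith, by linarith⟩]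

theorem bhatt_biased_ge {α ε m : ℝ} (hm : 0 < m) (hε : 0 ≤ ε) (h1 : m ≤ α - ε * d)
    (h2 : α + ε * d ≤ 1 - m) (a θ : Fin d → Bool) (i : Fin d) : 1 - 2 * ε ^ 2 / m ≤
    bhatt (feedbackLaw (biased α ε a θ)) (feedbackLaw (biased α ε a (flip i θ))) := by
  have h := abs_le.mp (abs_mul_corr_le hε a θ)
  have h' := abs_le.mp (abs_mul_corr_le hε a (flip i θ))
  have h3 := bhatt_feedbackLaw_ge (p := biased α ε a θ) (q := biased α ε a (flip i θ)) hm
  rw [coe_biased hm hε h1 h2, coe_biased hm hε h1 h2] at h3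
  refine le_trans (le_of_eq ?_)
    (h3 (by linarith) (by linarith) (by linarith) (by linarith))
  have h4 := corr_sub_flip_sq a θ i
  have h5 : (α + ε * corr a θ - (α + ε * corr a (flip i θ))) ^ 2 = ε ^ 2 * 4 := by
    rw [← h4]
    ring
  rw [h5]
  field_simp
  ring

/-- The vector with first coordinate `x` whose other coordinates are `y` times the signs `a`. -/
def signVec (x y : ℝ) (a : Fin d → Bool) : EuclideanSpace ℝ (Fin (d + 1)) :=
  WithLp.toLp 2 (Fin.cons x fun i => y * sgn (a i) : Fin (d + 1) → ℝ)

theorem norm_signVec_sq (x y : ℝ) (a : Fin d → Bool) :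
    ‖signVec x y a‖ ^ 2 = x ^ 2 + d * y ^ 2 := by
  rw [EuclideanSpace.real_norm_sq_eq, Fin.sum_univ_succ]
  simp [signVec, mul_pow, sgn_sq]

theorem norm_signVec_le {x y r : ℝ} (hr : 0 ≤ r) (h : x ^ 2 + d * y ^ 2 ≤ r ^ 2)
    (a : Fin d → Bool) : ‖signVec x y a‖ ≤ r := by
  rw [← norm_signVec_sq x y a] at h
  exact (sq_le_sq₀ (norm_nonneg _) hr).mp h

theorem inner_signVec (x y x' y' : ℝ) (a θ : Fin d → Bool) :
    inner ℝ (signVec x y a) (signVec x' y' θ) = x * x' + y * y' * corr a θ := by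
  rw [PiLp.inner_apply, Fin.sum_univ_succ, corr, Finset.mul_sum]
  simp only [signVec, Fin.cons_zero, Fin.cons_succ, RCLike.inner_apply, conj_trivial]
  congr 1
  · ring
  · exact Finset.sum_congr rfl fun i _ => by ring

theorem smul_signVec (c x y : ℝ) (a : Fin d → Bool) :
    c • signVec x y a = signVec (c * x) (c * y) a := by
  ext i
  refine Fin.cases ?_ (fun j => ?_) i <;> simp [signVec, mul_assoc]

theorem signVec_add (x y x' y' : ℝ) (a : Fin d → Bool) :
    signVec x y a + signVec x' y' a = signVec (x + x') (y + y') a := by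
  ext i
  refine Fin.cases ?_ (fun j => ?_) i <;> simp [signVec, add_mul]

end Signs

/-! ### Hard feedback functions on a one-state MDP -/

section HardFeedback

variable {d n : ℕ}

theorem exists_expectedRegret_ge_of_feedback {ε α : ℝ} {K : ℕ} (hε : 0 ≤ ε) (hα : 0 < α)
    (hα' : α ≤ 1 / 4) (h1 : ε * d ≤ α / 2) (hK : 1 ≤ K) (h2 : K * ε ^ 2 ≤ (α / 2) ^ 2)
    {Ω : Type*} [MeasurableSpace Ω] (ν : MeasureTheory.Measure Ω)
    [MeasureTheory.IsProbabilityMeasure ν] (alg : Algorithm Unit (Fin d → Bool) (n + 2) Ω) :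
    ∃ θ : Fin d → Bool, 2 * ε * d * K / 16 ≤
      expectedRegret (fun _ _ => PMF.pure ()) () (fun τ => biased α ε (τ 0).2 θ) ν alg K := by
  have hm : 0 < α / 2 := by linarith
  have hl : α / 2 ≤ α - ε * d := by linarith
  have hu : α + ε * d ≤ 1 - α / 2 := by linarith
  have hK1 : (1 : ℝ) ≤ K := by exact_mod_cast hK
  have hKδ : K * (2 * ε ^ 2 / (α / 2)) ≤ 1 / 2 := by
    rw [mul_div_assoc', div_le_iff₀ hm]
    nlinarith
  refine exists_expectedRegret_ge (fun _ _ _ => PMF.pure ()) ()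
    (fun θ τ => biased α ε (τ 0).2 θ) (v := α + ε * d) (δ := 2 * ε ^ 2 / (α / 2))
    (by positivity) (fun θ π => ?_) ?_ hKδ (fun θ i π => ?_) ν alg
  · rw [← sum_mul_corr]
    simp only [value, coe_biased hm hε hl hu]
    rw [sum_trajLaw_mul _ _ _ (fun a _ => α + ε * corr a θ)]
    simp
  · have : 0 ≤ 2 * ε ^ 2 / (α / 2) := by positivity
    nlinarith
  · rw [episodeLaw, episodeLaw, bhatt_pairLaw]
    have h := mul_bhatt_le (p := trajLaw (fun _ _ => PMF.pure ()) () π (n + 2))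
      (p' := trajLaw (fun _ _ => PMF.pure ()) () π (n + 2))
      fun τ => bhatt_biased_ge hm hε hl hu (τ 0).2 θ i
    rwa [bhatt_self, one_mul] at h

end HardFeedback

/-! ### Hard transitions with a known feedback function -/

section HardTransitions

variable {d n : ℕ}

/-- From the initial state `none` the action `a` leads to `some true` with probability `p a` and to
`some false` otherwise; these two states are absorbing. -/
def branching {A : Type} (p : A → unitInterval) : Option Bool → A → PMF (Option Bool)
  | none, a => (feedbackLaw (p a)).map some
  | some b, _ => PMF.pure (some b)

theorem map_some_some {X : Type} (p : PMF X) (x : X) : p.map some (some x) = p x := by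
  rw [PMF.map_apply, tsum_eq_single x]
  · simp
  · intro y hy
    simp [hy.symm]

theorem branching_none {A : Type} (p : A → unitInterval) (s : Option Bool) (a : A) :
    branching p s a none = 0 := by
  cases s <;> simp [branching]

theorem bhatt_branching_some {A : Type} (p q : A → unitInterval) (b : Bool) (a : A) :
    bhatt (branching p (some b) a) (branching q (some b) a) = 1 :=
  bhatt_self _

theorem bhatt_branching_none {A : Type} (p q : A → unitInterval) (a : A) :
    bhatt (branching p none a) (branching q none a) =
      bhatt (feedbackLaw (p a)) (feedbackLaw (q a)) := by
  simp [bhatt, branching, Fintype.sum_option]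

theorem trajLaw_branching_eq_zero {A : Type} (p : A → unitInterval) (π : Policy (Option Bool) A)
    (τ : Traj (Option Bool) A (n + 2)) (h : (τ (Fin.last (n + 1))).1 = none) :
    trajLaw (branching p) none π (n + 2) τ = 0 := by
  have hτ : τ = Fin.snoc (α := fun _ => Option Bool × A) (Fin.init τ)
      (none, (τ (Fin.last (n + 1))).2) := by
    rw [← h, Prod.mk.eta, Fin.snoc_init_self]
  rw [hτ, trajLaw_snoc, nextState, branching_none]
  simp

/-- Only the transition out of `none` carries information. It happens once, after which the state is
absorbed and the coefficient stays constant. -/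
theorem bhatt_trajLaw_branching_ge {A : Type} [Fintype A] {p q : A → unitInterval} {c : ℝ}
    (hc : c ≤ 1) (h : ∀ a, c ≤ bhatt (feedbackLaw (p a)) (feedbackLaw (q a)))
    (π : Policy (Option Bool) A) (n : ℕ) :
    c ≤ bhatt (trajLaw (branching p) none π (n + 2)) (trajLaw (branching q) none π (n + 2)) := by
  induction n with
  | zero =>
    -- The first state is fixed and no transition has occurred yet, so the two laws coincide by
    -- definition.
    have h1 : bhatt (trajLaw (branching p) none π 1) (trajLaw (branching q) none π 1) = 1 :=
      bhatt_self (trajLaw (branching p) none π 1)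
    rw [bhatt_trajLaw_succ, ← one_mul c, ← h1]
    refine mul_bhatt_le fun τ => ?_
    rw [nextState, nextState]
    cases (τ (Fin.last 0)).1 with
    | none => rw [bhatt_branching_none]; exact h _
    | some b => rw [bhatt_branching_some]; exact hc
  | succ n ih =>
    refine ih.trans (le_of_eq ?_)
    conv_lhs => rw [bhatt]
    rw [bhatt_trajLaw_succ]
    refine Finset.sum_congr rfl fun τ _ => ?_
    rw [nextState, nextState]
    cases hτ : (τ (Fin.last (n + 1))).1 with
    | none => simp [trajLaw_branching_eq_zero p π τ hτ]
    | some b => rw [bhatt_branching_some, mul_one]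

/-- The feedback with mean `γ` on the trajectories whose second state is `some true`. -/
def secondStateFeedback {A : Type} (γ : unitInterval) (τ : Traj (Option Bool) A (n + 2)) :
    unitInterval :=
  if (τ 1).1 = some true then γ else 0

theorem exists_expectedRegret_ge_of_transitions {ε : ℝ} {K : ℕ} (γ : unitInterval) (hε : 0 ≤ ε)
    (h1 : ε * d ≤ 1 / 4) (hK : 1 ≤ K) (h2 : K * ε ^ 2 ≤ (1 / 4) ^ 2)
    {Ω : Type*} [MeasurableSpace Ω] (ν : MeasureTheory.Measure Ω)
    [MeasureTheory.IsProbabilityMeasure ν]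
    (alg : Algorithm (Option Bool) (Fin d → Bool) (n + 2) Ω) :
    ∃ θ : Fin d → Bool, 2 * ε * γ * d * K / 16 ≤
      expectedRegret (branching fun a => biased (1 / 2) ε a θ) none (secondStateFeedback γ)
        ν alg K := by
  have hm : (0 : ℝ) < 1 / 4 := by norm_num
  have hl : 1 / 4 ≤ 1 / 2 - ε * d := by linarith
  have hu : 1 / 2 + ε * d ≤ 1 - 1 / 4 := by linarith
  have hK1 : (1 : ℝ) ≤ K := by exact_mod_cast hK
  have hδ : 2 * ε ^ 2 / (1 / 4) ≤ 1 := by nlinarith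
  have hγ : 0 ≤ (γ : ℝ) := γ.2.1
  refine exists_expectedRegret_ge (fun θ => branching fun a => biased (1 / 2) ε a θ) none
    (fun _ => secondStateFeedback γ) (v := γ * (1 / 2 + ε * d)) (δ := 2 * ε ^ 2 / (1 / 4))
    (by positivity) (fun θ π => ?_) hδ (by nlinarith) (fun θ i π => ?_) ν alg
  · have h3 : ∀ τ : Traj (Option Bool) (Fin d → Bool) (n + 2),
        (secondStateFeedback γ τ : ℝ) = if (τ 1).1 = some true then (γ : ℝ) else 0 := by
      intro τ
      unfold secondStateFeedback
      split_ifs <;> rfl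
    simp only [value, h3]
    rw [sum_trajLaw_mul _ _ _ (fun _ s => if s = some true then (γ : ℝ) else 0)]
    have h4 := sum_mul_corr π none θ (1 / 2) ε
    have h5 : ∀ a, ∑ s, (branching (fun a => biased (1 / 2) ε a θ) none a s).toReal *
        (if s = some true then (γ : ℝ) else 0) = (1 / 2 + ε * corr a θ) * γ := by
      intro a
      rw [← coe_biased hm hε hl hu]
      simp [branching, feedbackLaw_true]
    simp only [h5, ← mul_assoc, ← Finset.sum_mul]
    rw [h4]
    ring
  · rw [episodeLaw, episodeLaw, bhatt_pairLaw]
    simp only [bhatt_self, mul_one]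
    refine bhatt_trajLaw_branching_ge ?_ (fun a => bhatt_biased_ge hm hε hl hu a θ i) π n
    have : 0 ≤ 2 * ε ^ 2 / (1 / 4) := by positivity
    linarith

end HardTransitions

/-! ### Linear parametrisations of the hard instances -/

section LinearInstances

variable {d : ℕ}

theorem isLinearMixture_unit {A : Type} (e : ℕ) {B : ℝ} (hB : 1 ≤ B) :
    IsLinearMixture (fun (_ : Unit) (_ : A) (_ : Unit) =>
      (EuclideanSpace.single 0 1 : EuclideanSpace ℝ (Fin (e + 1)))) B fun _ _ => PMF.pure () :=
  ⟨EuclideanSpace.single 0 1, by simpa using hB, fun s a s' => by simp⟩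

theorem isMixtureFeature_unit {A : Type} (e : ℕ) :
    IsMixtureFeature (fun (_ : Unit) (_ : A) (_ : Unit) =>
      (EuclideanSpace.single 0 1 : EuclideanSpace ℝ (Fin (e + 1)))) := by
  intro s a V
  simpa [norm_smul, abs_of_nonneg (V ()).2.1] using (V ()).2.2

/-- Features of the first action, of norm `L`. -/
def actionFeature {S : Type} {n : ℕ} (L : ℝ) (τ : Traj S (Fin d → Bool) (n + 2)) :
    EuclideanSpace ℝ (Fin (d + 1)) :=
  signVec (L / √2) (L / √(2 * d)) (τ 0).2

theorem norm_actionFeature_le {S : Type} {n : ℕ} {L : ℝ} (hL : 0 ≤ L) (hd : 1 ≤ d)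
    (τ : Traj S (Fin d → Bool) (n + 2)) : ‖actionFeature L τ‖ ≤ L := by
  have hd' : (0 : ℝ) < d := by exact_mod_cast hd
  refine norm_signVec_le hL (le_of_eq ?_) _
  rw [div_pow, div_pow, Real.sq_sqrt (by positivity), Real.sq_sqrt (by positivity)]
  field_simp
  norm_num

theorem isLinearFeedback_biased {S : Type} {n : ℕ} {α ε m L M : ℝ} (hL : 0 < L) (hM : 0 < M)
    (hd : 1 ≤ d) (hm : 0 < m) (hε : 0 ≤ ε) (h1 : m ≤ α - ε * d) (h2 : α + ε * d ≤ 1 - m)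
    (hLM : 2 * α ≤ L * M) (θ : Fin d → Bool) :
    IsLinearFeedback (S := S) (actionFeature (n := n) L) M
      fun τ => biased α ε (τ 0).2 θ := by
  have hd' : (0 : ℝ) < d := by exact_mod_cast hd
  -- The squared norm is `2 * (α² + (ε d)²) / L²`, at most `(2 * α / L)²` since `ε * d ≤ α`.
  refine ⟨signVec (α * √2 / L) (ε * √(2 * d) / L) θ, ?_, fun τ => ?_⟩
  · refine norm_signVec_le hM.le ?_ _
    rw [div_pow, div_pow, mul_pow, mul_pow, Real.sq_sqrt (by positivity),
      Real.sq_sqrt (by positivity), mul_div_assoc', ← add_div, div_le_iff₀ (by positivity)]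
    have h3 : 0 ≤ ε * d := by positivity
    have h4 : (ε * d) ^ 2 ≤ α ^ 2 := pow_le_pow_left₀ h3 (by linarith) 2
    have h5 : (2 * α) ^ 2 ≤ (L * M) ^ 2 := pow_le_pow_left₀ (by linarith) hLM 2
    nlinarith
  · rw [actionFeature, inner_signVec, coe_biased hm hε h1 h2]
    field_simp

/-- Mixture features under which the transitions out of `none` depend linearly on the signs of the
action, and the other states are absorbing. -/
def branchingFeature : Option Bool → (Fin d → Bool) → Option Bool → EuclideanSpace ℝ (Fin (d + 1))
  | none, _, none => 0
  | none, a, some b => signVec (1 / 2) (sgn b / (2 * √d)) a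
  | some b, a, s => signVec (if s = some b then 1 else 0) 0 a

theorem isMixtureFeature_branchingFeature (hd : 1 ≤ d) :
    IsMixtureFeature (branchingFeature (d := d)) := by
  have hd' : (0 : ℝ) < d := by exact_mod_cast hd
  intro s a V
  cases s with
  | none =>
    rw [Fintype.sum_option, Fintype.sum_bool]
    simp only [branchingFeature, smul_zero, zero_add, smul_signVec, signVec_add, sgn, cond]
    refine norm_signVec_le zero_le_one ?_ _
    have ht := (V (some true)).2
    have hf := (V (some false)).2
    -- With `x` and `y` the two values of `V`, the squared norm is `((x + y)² + (x - y)²) / 4 = (x²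
    -- + y²) / 2`.
    have h : (V (some true) : ℝ) * (1 / (2 * √d)) + V (some false) * (-1 / (2 * √d)) =
        ((V (some true) : ℝ) - V (some false)) / (2 * √d) := by ring
    rw [h, div_pow, mul_pow, Real.sq_sqrt hd'.le]
    have h' : (d : ℝ) * (((V (some true) : ℝ) - V (some false)) ^ 2 / (2 ^ 2 * d)) =
        ((V (some true) : ℝ) - V (some false)) ^ 2 / 4 := by
      field_simp
      norm_num
    rw [h']
    nlinarith [ht.1, ht.2, hf.1, hf.2]
  | some b =>
    rw [Finset.sum_eq_single (some b)]
    · simp only [branchingFeature, smul_signVec, if_true, mul_one, mul_zero]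
      refine norm_signVec_le zero_le_one ?_ _
      have h := (V (some b)).2
      nlinarith [h.1, h.2]
    · intro s _ hs
      have h : signVec 0 0 a = 0 := by
        rw [← norm_eq_zero, ← sq_eq_zero_iff, norm_signVec_sq]
        simp
      simp [branchingFeature, hs, h]
    · simp

theorem isLinearMixture_branching {ε B : ℝ} (hd : 1 ≤ d) (hε : 0 ≤ ε) (h1 : ε * d ≤ 1 / 4)
    (hB : 0 ≤ B) (h2 : 1 + 4 * (ε * d) ^ 2 ≤ B ^ 2) (θ : Fin d → Bool) :
    IsLinearMixture branchingFeature B (branching fun a => biased (1 / 2) ε a θ) := by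
  have hd' : (0 : ℝ) < d := by exact_mod_cast hd
  -- The first coordinate must be 1 because of the absorbing states; the sign part adds `4 * (ε d)²`
  -- to the squared norm, which is where the slack `B₀ > 1` is needed.
  refine ⟨signVec 1 (2 * ε * √d) θ, norm_signVec_le hB ?_ _, fun s a s' => ?_⟩
  · rw [mul_pow, Real.sq_sqrt hd'.le]
    nlinarith
  · have hp := coe_biased (by norm_num : (0 : ℝ) < 1 / 4) hε (by linarith : 1 / 4 ≤ 1 / 2 - ε * d)
      (by linarith) a θ
    cases s with
    | none =>
      cases s' with
      | none => simp [branching, branchingFeature]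
      | some b =>
        rw [branching, map_some_some, branchingFeature, inner_signVec]
        cases b with
        | true =>
          rw [feedbackLaw_true, hp, sgn, cond]
          field_simp
        | false =>
          rw [feedbackLaw_false, hp, sgn, cond]
          field_simp
          ring
    | some b =>
      rw [branching, branchingFeature, inner_signVec, PMF.pure_apply]
      split_ifs <;> simp

/-- The feature `L` of the trajectories whose second state is `some true`. -/
def secondStateFeature {A : Type} {n : ℕ} (e : ℕ) (L : ℝ) (τ : Traj (Option Bool) A (n + 2)) :
    EuclideanSpace ℝ (Fin (e + 1)) :=
  EuclideanSpace.single 0 (if (τ 1).1 = some true then L else 0)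

theorem norm_secondStateFeature_le {A : Type} {n : ℕ} (e : ℕ) {L : ℝ} (hL : 0 ≤ L)
    (τ : Traj (Option Bool) A (n + 2)) : ‖secondStateFeature e L τ‖ ≤ L := by
  rw [secondStateFeature, PiLp.norm_single]
  split_ifs <;> simp [abs_of_nonneg hL, hL]

theorem isLinearFeedback_secondStateFeedback {A : Type} {n : ℕ} (e : ℕ) {L M : ℝ} (hL : 0 < L)
    {γ : unitInterval} (hγ : γ ≤ L * M) :
    IsLinearFeedback (secondStateFeature (A := A) (n := n) e L) M (secondStateFeedback γ) := by
  refine ⟨EuclideanSpace.single 0 (γ / L), ?_, fun τ => ?_⟩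
  · rw [PiLp.norm_single, Real.norm_of_nonneg (div_nonneg γ.2.1 hL.le),
      div_le_iff₀ hL, mul_comm]
    exact hγ
  · rw [secondStateFeature, secondStateFeedback, EuclideanSpace.inner_single_left]
    split_ifs
    · simp [mul_div_cancel₀ _ hL.ne']
    · simp

end LinearInstances

/-! ### Choice of the scale and conclusion -/

/-- Here `c / √K` plays the role of `ε`: `K ≥ d²` keeps the total bias `ε * d` bounded, while `K *
ε²` stays constant. -/
theorem scale_div_sqrt {c : ℝ} (hc : 0 ≤ c) {d K : ℕ} (hK : 1 ≤ K) (hdK : d ^ 2 ≤ K) :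
    0 ≤ c / √K ∧ c / √K * d ≤ c ∧ K * (c / √K) ^ 2 = c ^ 2 ∧ c / √K * K = c * √K := by
  have hK' : (0 : ℝ) < K := by exact_mod_cast hK
  have hs : 0 < √(K : ℝ) := Real.sqrt_pos.mpr hK'
  have hss : √(K : ℝ) ^ 2 = K := Real.sq_sqrt hK'.le
  have hd : (d : ℝ) ≤ √K := Real.le_sqrt_of_sq_le (by exact_mod_cast hdK)
  refine ⟨by positivity, ?_, ?_, ?_⟩
  · rw [div_mul_eq_mul_div, div_le_iff₀ hs]
    gcongr
  · rw [div_pow, hss]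
    field_simp
  · rw [div_mul_eq_mul_div, div_eq_iff hs.ne', mul_assoc, ← sq, hss]

end

end OnceRL

theorem mainTheorem4 (B₀ ρ : ℝ) (hB₀ : 1 < B₀) (hρ : 0 < ρ) :
    ∃ c : ℝ, 0 < c ∧
      ∀ (B L M : ℝ), B₀ ≤ B → 0 < L → 0 < M → ρ ≤ L * M →
      ∀ (dP dG H : ℕ), 1 ≤ dP → 1 ≤ dG → 3 ≤ dP + dG → 2 ≤ H →
      ∃ (S A : Type) (_ : Fintype S) (_ : Fintype A) (_ : Nonempty A) (s₁ : S)
        (ψ : S → A → S → EuclideanSpace ℝ (Fin dP))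
        (φ : OnceRL.Traj S A H → EuclideanSpace ℝ (Fin dG)),
        OnceRL.IsMixtureFeature ψ ∧ (∀ τ, ‖φ τ‖ ≤ L) ∧
        ∀ (K : ℕ), dP ^ 2 ≤ K → dG ^ 2 ≤ K →
        ∀ (Ω : Type*) [MeasurableSpace Ω] (ν : MeasureTheory.Measure Ω)
          [MeasureTheory.IsProbabilityMeasure ν] (alg : OnceRL.Algorithm S A H Ω),
        ∃ (P : S → A → PMF S) (g : OnceRL.Traj S A H → unitInterval),
          OnceRL.IsLinearMixture ψ B P ∧ OnceRL.IsLinearFeedback φ M g ∧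
          c * (dP * √K + dG * √K) ≤ OnceRL.expectedRegret P s₁ g ν alg K := by
  set α : ℝ := min ρ 1 / 4 with hα_def
  have hα : 0 < α := by positivity
  have hα4 : α ≤ 1 / 4 := by linarith [min_le_right ρ 1]
  have hαρ : 2 * α ≤ ρ := by linarith [min_le_left ρ 1]
  let γ : unitInterval := ⟨min ρ 1, by positivity, min_le_right _ _⟩
  have hγ : (0 : ℝ) < γ := show 0 < min ρ 1 by positivity
  set β : ℝ := min (1 / 4) ((B₀ - 1) / 2) with hβ_def
  have hβ : 0 < β := lt_min (by norm_num) (by linarith)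
  have hβ4 : β ≤ 1 / 4 := min_le_left _ _
  have hβB : β ≤ (B₀ - 1) / 2 := min_le_right _ _
  -- The factor 32 is 4, from `p + q + 2 ≤ 4 * max p q`, times 8, from `gap / 16` with `gap` equal
  -- to `2 * ε` or `2 * ε * γ`.
  set c : ℝ := min (α / 2) (β * γ) / 32 with hc_def
  have hcα : c * 32 ≤ α / 2 := by linarith [min_le_left (α / 2) (β * γ)]
  have hcβ : c * 32 ≤ β * γ := by linarith [min_le_right (α / 2) (β * γ)]
  refine ⟨c, by positivity, fun B L M hB hL hM hLM dP dG H hP hG hPG hH => ?_⟩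
  have hc : 0 < c := by positivity
  obtain ⟨n, rfl⟩ := Nat.exists_eq_add_of_le' hH
  obtain ⟨p, rfl⟩ := Nat.exists_eq_add_of_le' hP
  obtain ⟨q, rfl⟩ := Nat.exists_eq_add_of_le' hG
  rcases le_or_gt p q with hpq | hpq
  -- The dimensions are `p + 1` and `q + 1`; since they are not both 1, the larger leaves at least
  -- one sign coordinate.
  · have hq : 1 ≤ q := by omega
    refine ⟨Unit, Fin q → Bool, inferInstance, inferInstance, inferInstance, (), _,
      OnceRL.actionFeature L, OnceRL.isMixtureFeature_unit p,
      OnceRL.norm_actionFeature_le hL.le hq, fun K _ hGK Ω _ ν _ alg => ?_⟩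
    have hK : 1 ≤ K := by nlinarith
    obtain ⟨h0, h1, h2, h3⟩ := OnceRL.scale_div_sqrt (half_pos hα).le hK
      (show q ^ 2 ≤ K by nlinarith)
    obtain ⟨θ, hθ⟩ := OnceRL.exists_expectedRegret_ge_of_feedback h0 hα hα4 h1 hK h2.le ν alg
    refine ⟨_, _, OnceRL.isLinearMixture_unit p (by linarith),
      OnceRL.isLinearFeedback_biased hL hM hq (half_pos hα) h0 (by linarith) (by linarith)
        (by linarith) θ, le_trans ?_ hθ⟩
    have hpq' : (p : ℝ) ≤ q := by exact_mod_cast hpq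
    have hq' : (1 : ℝ) ≤ q := by exact_mod_cast hq
    calc c * (((p + 1 : ℕ) : ℝ) * √K + ((q + 1 : ℕ) : ℝ) * √K)
        = c * √K * (p + q + 2) := by push_cast; ring
      _ ≤ c * √K * (4 * q) := by gcongr; linarith
      _ = c * 32 * √K * q / 8 := by ring
      _ ≤ α / 2 * √K * q / 8 := by gcongr
      _ = 2 * (α / 2 / √K) * q * K / 16 := by rw [← h3]; ring
  · have hp : 1 ≤ p := by omega
    refine ⟨Option Bool, Fin p → Bool, inferInstance, inferInstance, inferInstance, none,
      OnceRL.branchingFeature, OnceRL.secondStateFeature q L,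
      OnceRL.isMixtureFeature_branchingFeature hp,
      OnceRL.norm_secondStateFeature_le q hL.le, fun K hPK _ Ω _ ν _ alg => ?_⟩
    have hK : 1 ≤ K := by nlinarith
    obtain ⟨h0, h1, h2, h3⟩ := OnceRL.scale_div_sqrt hβ.le hK (show p ^ 2 ≤ K by nlinarith)
    obtain ⟨θ, hθ⟩ := OnceRL.exists_expectedRegret_ge_of_transitions γ h0 (h1.trans hβ4) hK
      (h2.le.trans (pow_le_pow_left₀ hβ.le hβ4 2)) ν alg
    refine ⟨_, _, OnceRL.isLinearMixture_branching hp h0 (h1.trans hβ4) (by linarith) ?_ θ,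
      OnceRL.isLinearFeedback_secondStateFeedback q hL (γ := γ) ((min_le_left _ _).trans hLM),
      le_trans ?_ hθ⟩
    -- By the choice of `β`, `1 + 4 * β² ≤ 1 + (B₀ - 1)² ≤ B₀²`.
    · have h4 : (β / √K * p) ^ 2 ≤ β ^ 2 := pow_le_pow_left₀ (by positivity) h1 2
      nlinarith
    have hpq' : (q : ℝ) ≤ p := by exact_mod_cast hpq.le
    have hp' : (1 : ℝ) ≤ p := by exact_mod_cast hp
    calc c * (((p + 1 : ℕ) : ℝ) * √K + ((q + 1 : ℕ) : ℝ) * √K)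
        = c * √K * (p + q + 2) := by push_cast; ring
      _ ≤ c * √K * (4 * p) := by gcongr; linarith
      _ = c * 32 * √K * p / 8 := by ring
      _ ≤ β * γ * √K * p / 8 := by gcongr
      _ = γ * p * (β * √K) / 8 := by ring
      _ = 2 * (β / √K) * γ * p * K / 16 := by rw [← h3]; ring
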